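/- Let $K\subseteq\mathbb F_2^s$ be a nonzero binary linear code of length $s$, let $A_u$ be the number of its codewords of Hamming weight $u$, let $A(z)=\sum_{u=0}^s A_uz^u=1+\sum_{u=r}^s A_uz^u$ be its weight enumerating function ($r$ the minimum distance), and let $\bar u$ be the largest $u\in\{r,\dots,s\}$ with $A_u>0$. Let $q\ge1$ be an integer. For each positive integer $n$ such that $s\mid nq$ consider the Tanner code ensemble $\mathcal M_n$ with $n$ variable nodes, each a repetition code of length $q$, and $nq/s$ check nodes, each with local code $K$: the $nq$ variable-node sockets are joined to the $nq$ check-node sockets by a bijection chosen uniformly among all $(nq)!$ bijections, and a codeword is a vector $x\in\mathbb F_2^n$ such that, when every edge carries the bit $x_i$ of the variable node $i$ it is attached to, each check node sees a codeword of $K$. Let $A_w$ also denote the number of codewords of weight $w$ of a code drawn from $\mathcal M_n$, and define the weight spectral shape $$G(\alpha)=\lim_{n\to\infty}\frac1n\log\mathbb E_{\mathcal M_n}[A_{\alpha n}],$$ where the limit is over those positive integers $n$ with $s\mid nq$ for which $\alpha n$ is an integer and $\mathbb E_{\mathcal M_n}[A_{\alpha n}]>0$. Put $f(z)=\dfrac{zA'(z)}{s\,A(z)}$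 for $z\ge0$. Then $f$ is a bijection from $[0,\infty)$ onto $[0,\bar u/s)$, so that $f^{-1}:[0,\bar u/s)\to[0,\infty)$ is well defined. Moreover, for every rational $\alpha\in[0,\bar u/s)$, infinitely many $n$ take part in the limit above, the limit $G(\alpha)$ exists, and $$G(\alpha)=(1-q)\,h(\alpha)-q\,\alpha\log f^{-1}(\alpha)+\frac qs\log A\big(f^{-1}(\alpha)\big),$$ where $\log$ is the natural logarithm, $h(x)=-x\log x-(1-x)\log(1-x)$, and $0\log0=0$. -/

import Mathlib

open scoped Topology

namespace TannerEnsemble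

noncomputable section

/-- A binary linear code of length `s`. -/
abbrev LinCode (s : ℕ) := Submodule (ZMod 2) (Fin s → ZMod 2)

/-- `A_u`: the number of codewords of Hamming weight `u`. -/
def weightCount {s : ℕ} (K : LinCode s) (u : ℕ) : ℕ :=
  Set.ncard {c : Fin s → ZMod 2 | c ∈ K ∧ hammingNorm c = u}

/-- The weight enumerating function `A(z) = ∑ u, A_u z ^ u`. For a linear code `A_0 = 1`, and
`A_u = 0` for `u` strictly between `0` and the minimum distance. -/
def wef {s : ℕ} (K : LinCode s) : Polynomial ℝ :=
  ∑ u ∈ Finset.range (s + 1), Polynomial.monomial u (weightCount K u : ℝ)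

/-- The minimum distance `r` (least weight of a nonzero codeword) of a nonzero linear code. -/
def minDist {s : ℕ} (K : LinCode s) : ℕ :=
  sInf {d : ℕ | ∃ c ∈ K, c ≠ 0 ∧ hammingNorm c = d}

/-- The maximal codeword weight `ū` of a nonzero linear code: the largest `u ∈ {r, …, s}` with
`A_u > 0`. -/
def maxWeight {s : ℕ} (K : LinCode s) : ℕ :=
  sSup {u : ℕ | u ∈ Finset.Icc (minDist K) s ∧ 0 < weightCount K u}

/-- The encoder of the length-`q` repetition code (one information bit). -/
def repEncode (q : ℕ) (b : ZMod 2) : Fin q → ZMod 2 := fun _ => b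

/-- A Tanner graph: the sockets of the `n` variable nodes (of length `q`) are joined one-to-one to
the sockets of the check nodes (of length `s`). There are `n q` edges, hence `n q / s` check nodes;
such graphs exist only if `s ∣ n q`, and then there are `(n q)!` of them. -/
abbrev TannerGraph (s q n : ℕ) := (Fin n × Fin q) ≃ (Fin (n * q / s) × Fin s)

/-- The word that check node `j` receives when the variable nodes carry the bits `x`. -/
def checkInput {s q n : ℕ} (π : TannerGraph s q n) (x : Fin n → ZMod 2)
    (j : Fin (n * q / s)) : Fin s → ZMod 2 :=
  fun b => repEncode q (x (π.symm (j, b)).1) (π.symm (j, b)).2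

/-- The Tanner code: the assignments of the information bits of the variable nodes for which every
check node recognizes a codeword of its local code `K`. -/
def tannerCode {s q n : ℕ} (K : LinCode s) (π : TannerGraph s q n) : Set (Fin n → ZMod 2) :=
  {x | ∀ j, checkInput π x j ∈ K}

/-- The number of codewords of weight `w` of the Tanner code of the graph `π`. -/
def numCodewords {s q n : ℕ} (K : LinCode s) (π : TannerGraph s q n) (w : ℕ) : ℕ :=
  Set.ncard {x : Fin n → ZMod 2 | x ∈ tannerCode K π ∧ hammingNorm x = w}

/-- The expected number of weight-`w` codewords of a code drawn uniformly at random from the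
ensemble with `n` variable nodes. -/
def expectedCount {s : ℕ} (K : LinCode s) (q n w : ℕ) : ℝ :=
  (∑ π : TannerGraph s q n, (numCodewords K π w : ℝ)) / (Fintype.card (TannerGraph s q n) : ℝ)

/-- The positive integers `n` that take part in the limit defining the spectral shape at `α`: the
ensemble with `n` variable nodes exists, `α n` is a (nonnegative) integer, and the expected number
of codewords of weight `α n` is positive. -/
def admissible {s : ℕ} (K : LinCode s) (q : ℕ) (α : ℝ) : Set ℕ :=
  {n : ℕ | 0 < n ∧ s ∣ n * q ∧ ∃ w : ℕ, (w : ℝ) = α * n ∧ 0 < expectedCount K q n w}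

/-- The weight spectral shape at `α` exists and equals `g`: there are infinitely many admissible
`n`, and `(1 / n) log E[A_{α n}] → g` as `n → ∞` through the admissible `n`. (For admissible `n` the
number `α n` is a natural number, equal to its floor.) -/
def HasSpectralShapeAt {s : ℕ} (K : LinCode s) (q : ℕ) (α g : ℝ) : Prop :=
  (admissible K q α).Infinite ∧
    Filter.Tendsto (fun n : ℕ => 1 / (n : ℝ) * Real.log (expectedCount K q n ⌊α * n⌋₊))
      (Filter.atTop ⊓ Filter.principal (admissible K q α)) (𝓝 g)

/-- `f(z) = z A'(z) / (s A(z))`. -/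
def f {s : ℕ} (K : LinCode s) (z : ℝ) : ℝ :=
  z * (wef K).derivative.eval z / ((s : ℝ) * (wef K).eval z)

/-- The inverse of `f` restricted to `[0, ∞)`. -/
def fInv {s : ℕ} (K : LinCode s) (α : ℝ) : ℝ :=
  Function.invFunOn (f K) (Set.Ici 0) α

end

end TannerEnsemble

/-! A uniform socket matching carries the `w q` sockets labelled 1 to a uniform `w q`-subset of the
check sockets. Hence E[A_w] = C(n,w) · [X^(wq)] A^(nq/s) / C(nq,wq) (`expectedCount_eq`). The two
binomials contribute (1 - q) h(α); what remains is the growth rate of [X^(βm)] P^m for P = A, m =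
nq/s, β = αs. `tendsto_log_coeff_pow` computes it as log P(z) - β log z, where z P'(z) = β P(z);
with P = 1 + X it also gives the binomials.

Upper bound: a single nonnegative term of P(z)^m is at most the whole. Lower bound: weighting the
coefficients of P^m by z^k gives a distribution with mean βm and variance O(m), so by Chebyshev some
exponent near βm has a coefficient of the right order (`exists_coeff_in_window`). Multiplying by a
small further power of P moves that exponent to exactly the proportion β (`exists_coeff_pow_large`).
Supermultiplicativity of the coefficients then spreads the bound, up to an additive constant, to
every m whose coefficient is positive (`log_coeff_pow_ge`), so gaps in the set of weights do no
harm.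

The function f is 1/s times the mean of the tilted weight distribution: it increases strictly from 0
towards ū/s, which it never attains (`bijOn_f`). -/

namespace TannerEnsemble

open Polynomial Filter Topology

/-! ### The Euler operator and powers of polynomials with nonnegative coefficients -/

/-- The Euler operator `z d/dz`. -/
noncomputable def euler (P : ℝ[X]) : ℝ[X] := X * derivative P

lemma coeff_euler (P : ℝ[X]) (n : ℕ) : (euler P).coeff n = n * P.coeff n := by
  cases n with
  | zero => simp [euler]
  | succ n => rw [euler, coeff_X_mul, coeff_derivative]; push_cast; ring

lemma natDegree_euler_le (P : ℝ[X]) : (euler P).natDegree ≤ P.natDegree := by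
  rw [natDegree_le_iff_coeff_eq_zero]
  intro n hn
  rw [coeff_euler, coeff_eq_zero_of_natDegree_lt hn, mul_zero]

lemma eval_eq_sum_lt (P : ℝ[X]) {N : ℕ} (hN : P.natDegree < N) (z : ℝ) :
    P.eval z = ∑ k ∈ Finset.range N, P.coeff k * z ^ k :=
  eval_eq_sum_range' hN z

lemma eval_euler_eq_sum (P : ℝ[X]) {N : ℕ} (hN : P.natDegree < N) (z : ℝ) :
    (euler P).eval z = ∑ k ∈ Finset.range N, (k : ℝ) * (P.coeff k * z ^ k) := by
  rw [eval_eq_sum_lt _ ((natDegree_euler_le P).trans_lt hN)]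
  exact Finset.sum_congr rfl fun k _ => by rw [coeff_euler, mul_assoc]

lemma coeff_mul_nonneg {P Q : ℝ[X]} (hP : ∀ n, 0 ≤ P.coeff n) (hQ : ∀ n, 0 ≤ Q.coeff n) (n : ℕ) :
    0 ≤ (P * Q).coeff n := by
  rw [coeff_mul]
  exact Finset.sum_nonneg fun x _ => mul_nonneg (hP _) (hQ _)

lemma coeff_pow_nonneg {P : ℝ[X]} (hP : ∀ n, 0 ≤ P.coeff n) (m n : ℕ) : 0 ≤ (P ^ m).coeff n := by
  induction m generalizing n with
  | zero => rw [pow_zero, coeff_one]; split_ifs <;> norm_num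
  | succ m ih => rw [pow_succ]; exact coeff_mul_nonneg ih hP n

lemma coeff_mul_coeff_le {P Q : ℝ[X]} (hP : ∀ n, 0 ≤ P.coeff n) (hQ : ∀ n, 0 ≤ Q.coeff n)
    (k l : ℕ) : P.coeff k * Q.coeff l ≤ (P * Q).coeff (k + l) := by
  rw [coeff_mul]
  exact Finset.single_le_sum (f := fun x : ℕ × ℕ => P.coeff x.1 * Q.coeff x.2)
    (fun x _ => mul_nonneg (hP _) (hQ _)) (Finset.HasAntidiagonal.mem_antidiagonal.2 (rfl : (k, l).1 + (k, l).2 = k + l))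

/-- The product on the left is one term of the convolution, and all other terms are nonnegative.
This supermultiplicativity drives every lower bound below. -/
lemma coeff_pow_supermul {P : ℝ[X]} (hP : ∀ n, 0 ≤ P.coeff n) (m n k l : ℕ) :
    (P ^ m).coeff k * (P ^ n).coeff l ≤ (P ^ (m + n)).coeff (k + l) := by
  rw [pow_add]
  exact coeff_mul_coeff_le (coeff_pow_nonneg hP m) (coeff_pow_nonneg hP n) k l

lemma pow_coeff_le_coeff_pow_mul {P : ℝ[X]} (hP : ∀ n, 0 ≤ P.coeff n) (m k t : ℕ) :
    ((P ^ m).coeff k) ^ t ≤ (P ^ (m * t)).coeff (k * t) := by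
  induction t with
  | zero => simp
  | succ t ih =>
    rw [pow_succ, Nat.mul_succ, Nat.mul_succ]
    exact (mul_le_mul_of_nonneg_right ih (coeff_pow_nonneg hP m k)).trans
      (coeff_pow_supermul hP _ _ _ _)

/-- Take X^d from `j` of the factors and the constant term from the others. -/
lemma one_le_coeff_pow_mul {P : ℝ[X]} (hP : ∀ n, 0 ≤ P.coeff n) (h0 : 1 ≤ P.coeff 0) {d : ℕ}
    (hd : 1 ≤ P.coeff d) {j m : ℕ} (hj : j ≤ m) : 1 ≤ (P ^ m).coeff (d * j) := by
  obtain ⟨i, rfl⟩ := Nat.exists_eq_add_of_le hj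
  have h1 := pow_coeff_le_coeff_pow_mul hP 1 d j
  have h2 := pow_coeff_le_coeff_pow_mul hP 1 0 i
  have h3 := coeff_pow_supermul hP j i (d * j) 0
  simp only [pow_one, one_mul, zero_mul, add_zero] at h1 h2 h3
  have h4 : (1 : ℝ) ≤ (P.coeff d) ^ j := one_le_pow₀ hd
  have h5 : (1 : ℝ) ≤ (P.coeff 0) ^ i := one_le_pow₀ h0
  refine le_trans ?_ h3
  exact one_le_mul_of_one_le_of_one_le (h4.trans h1) (h5.trans h2)

/-! ### Growth rate of the coefficients of powers -/

lemma coeff_mul_pow_le_eval {P : ℝ[X]} (hP : ∀ n, 0 ≤ P.coeff n) {z : ℝ} (hz : 0 ≤ z) (k : ℕ) :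
    P.coeff k * z ^ k ≤ P.eval z := by
  rw [eval_eq_sum_lt P (N := max P.natDegree k + 1) (by omega)]
  exact Finset.single_le_sum (f := fun k => P.coeff k * z ^ k)
    (fun i _ => mul_nonneg (hP i) (pow_nonneg hz i)) (Finset.mem_range.2 (by omega))

lemma one_le_eval {P : ℝ[X]} (hP : ∀ n, 0 ≤ P.coeff n) (h0 : 1 ≤ P.coeff 0) {z : ℝ} (hz : 0 ≤ z) :
    1 ≤ P.eval z := by
  have := coeff_mul_pow_le_eval hP hz 0
  rw [pow_zero, mul_one] at this
  exact h0.trans this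

/-- The Chernoff bound: one term of P(z)^m is at most the whole sum. It holds for every z > 0; the
saddle point makes it sharp. -/
lemma log_coeff_pow_le {P : ℝ[X]} (hP : ∀ n, 0 ≤ P.coeff n) {z : ℝ} (hz : 0 < z)
    {m k : ℕ} (hc : 0 < (P ^ m).coeff k) :
    Real.log ((P ^ m).coeff k) ≤ m * Real.log (P.eval z) - k * Real.log z := by
  have h := coeff_mul_pow_le_eval (coeff_pow_nonneg hP m) hz.le k
  have hzk : 0 < z ^ k := pow_pos hz k
  have h2 := Real.log_le_log (mul_pos hc hzk) h
  rw [Real.log_mul hc.ne' hzk.ne', eval_pow, Real.log_pow, Real.log_pow] at h2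
  linarith

/-- The variance of the `z`-tilted distribution given by the coefficients of `P ^ m` grows at most
linearly in `m`. -/
lemma sum_sq_dev_le {P : ℝ[X]} {z β : ℝ} (hp : 1 ≤ P.eval z)
    (hβ : (euler P).eval z = β * P.eval z) (hγ : 0 ≤ (euler (euler P)).eval z)
    {m N : ℕ} (hm : 2 ≤ m) (hN : (P ^ m).natDegree < N) :
    ∑ k ∈ Finset.range N, ((k : ℝ) - β * m) ^ 2 * ((P ^ m).coeff k * z ^ k) ≤
      m * (euler (euler P)).eval z * P.eval z ^ m := by
  have key : ∑ k ∈ Finset.range N, ((k : ℝ) - β * m) ^ 2 * ((P ^ m).coeff k * z ^ k) =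
      (euler (euler (P ^ m))).eval z - 2 * (β * m) * (euler (P ^ m)).eval z
        + (β * m) ^ 2 * (P ^ m).eval z := by
    rw [eval_euler_eq_sum _ ((natDegree_euler_le _).trans_lt hN), eval_euler_eq_sum _ hN,
      eval_eq_sum_lt _ hN, Finset.mul_sum, Finset.mul_sum, ← Finset.sum_sub_distrib,
      ← Finset.sum_add_distrib]
    refine Finset.sum_congr rfl fun k _ => ?_
    rw [coeff_euler]; ring
  -- With m = n + 2 the exponents m - 1 and m - 2 produced by two derivatives involve no truncated
  -- subtraction.
  obtain ⟨n, rfl⟩ := Nat.exists_eq_add_of_le' hm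
  have e1 : euler (P ^ (n + 2)) = C ((n : ℝ) + 2) * P ^ (n + 1) * euler P := by
    simp only [euler, derivative_pow]; push_cast [Nat.add_sub_cancel]
    ring
  have e2 : euler (euler (P ^ (n + 2))) = C ((n : ℝ) + 2) * (C ((n : ℝ) + 1) * P ^ n *
      euler P * euler P + P ^ (n + 1) * euler (euler P)) := by
    rw [e1]
    simp only [euler, derivative_mul, derivative_C, derivative_pow, derivative_X]
    push_cast [Nat.add_sub_cancel]
    ring
  rw [key, e2, e1]
  simp only [eval_mul, eval_add, eval_C, eval_pow, hβ]
  set p := P.eval z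
  set g := (euler (euler P)).eval z
  push_cast
  -- The sum equals m g p^(m-1) - m β² p^m exactly; `h1` and `h2` are the two parts of the slack,
  -- the first using p ≥ 1.
  have h1 : 0 ≤ (n + 2 : ℝ) * g * (p ^ (n + 1) * (p - 1)) := by
    have : 0 ≤ p - 1 := by linarith
    positivity
  have h2 : 0 ≤ (n + 2 : ℝ) * β ^ 2 * p ^ (n + 2) := by positivity
  have h3 : (n + 2 : ℝ) * g * p ^ (n + 2) - ((n + 2) * ((n + 1) * p ^ n * (β * p) * (β * p) +
      p ^ (n + 1) * g) - 2 * (β * (n + 2)) * ((n + 2) * p ^ (n + 1) * (β * p)) +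
      (β * (n + 2)) ^ 2 * p ^ (n + 2)) =
      (n + 2 : ℝ) * g * (p ^ (n + 1) * (p - 1)) + (n + 2 : ℝ) * β ^ 2 * p ^ (n + 2) := by ring
  linarith

/-- Chebyshev plus pigeonhole: once m > 2g/ε², the terms outside the window carry at most half of
P(z)^m. The other half is shared by at most m · deg P + 1 terms, so one of them is large. -/
lemma exists_coeff_in_window {P : ℝ[X]} (hP : ∀ n, 0 ≤ P.coeff n) (h0 : 1 ≤ P.coeff 0)
    {z β : ℝ} (hz : 0 < z) (hβ : (euler P).eval z = β * P.eval z) {ε : ℝ} (hε : 0 < ε) :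
    ∃ M : ℕ, ∀ m ≥ M, ∃ k : ℕ, |(k : ℝ) - β * m| ≤ ε * m ∧
      P.eval z ^ m ≤ 2 * (m * P.natDegree + 1) * ((P ^ m).coeff k * z ^ k) := by
  set p := P.eval z with hpdef
  set g := (euler (euler P)).eval z with hg
  have hp : 1 ≤ p := one_le_eval hP h0 hz.le
  have hγ : 0 ≤ g := by
    rw [hg, eval_euler_eq_sum _ (lt_add_one _)]
    refine Finset.sum_nonneg fun k _ => ?_
    rw [coeff_euler]
    have := hP k
    positivity
  obtain ⟨M, hM⟩ := exists_nat_gt (2 * g / ε ^ 2)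
  refine ⟨M + 2, fun m hm => ?_⟩
  by_contra hcon
  push Not at hcon
  set N := m * P.natDegree + 1 with hN
  have hNdeg : (P ^ m).natDegree < N := Nat.lt_succ_of_le natDegree_pow_le
  have hsum := sum_sq_dev_le hp hβ hγ (m := m) (by omega) hNdeg
  have hmpos : (0 : ℝ) < m := by exact_mod_cast (by omega : 0 < m)
  have hMm : 2 * g / ε ^ 2 < m := hM.trans (by exact_mod_cast (by omega : M < m))
  have hpm : 0 < p ^ m := by positivity
  set c : ℕ → ℝ := fun k => (P ^ m).coeff k * z ^ k with hc
  have hc0 : ∀ k, 0 ≤ c k := fun k => mul_nonneg (coeff_pow_nonneg hP m k) (by positivity)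
  have htot : ∑ k ∈ Finset.range N, c k = p ^ m := by
    rw [hpdef, ← eval_pow, eval_eq_sum_lt _ hNdeg]
  have hNpos : (0 : ℝ) < N := by positivity
  -- Inside the window the first summand suffices, by the negated conclusion; outside, the Chebyshev
  -- factor is at least 1. Summing over k gives p^m < p^m/2 + p^m/2.
  have hbd : ∀ k ∈ Finset.range N,
      c k < p ^ m / (2 * N) + ((k : ℝ) - β * m) ^ 2 * c k / (ε * m) ^ 2 := by
    intro k _
    by_cases hk : |(k : ℝ) - β * m| ≤ ε * m
    · have h1 := hcon k hk
      have h2 : c k < p ^ m / (2 * N) := by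
        rw [lt_div_iff₀ (by positivity)]
        have : (N : ℝ) = m * P.natDegree + 1 := by rw [hN]; push_cast; ring
        rw [this]; linarith
      have := hc0 k
      have : 0 ≤ ((k : ℝ) - β * m) ^ 2 * c k / (ε * m) ^ 2 := by positivity
      linarith
    · push Not at hk
      have h1 : (ε * m) ^ 2 ≤ ((k : ℝ) - β * m) ^ 2 := by
        rw [← sq_abs ((k : ℝ) - β * m)]
        exact pow_le_pow_left₀ (by positivity) hk.le 2
      have h2 : c k ≤ ((k : ℝ) - β * m) ^ 2 * c k / (ε * m) ^ 2 := by
        rw [le_div_iff₀ (by positivity)]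
        nlinarith [hc0 k]
      have : 0 < p ^ m / (2 * N) := by positivity
      linarith
  have hlt := Finset.sum_lt_sum_of_nonempty (by rw [Finset.nonempty_range_iff]; omega) hbd
  rw [htot, Finset.sum_add_distrib, Finset.sum_const, Finset.card_range, nsmul_eq_mul,
    ← Finset.sum_div] at hlt
  have h3 : (∑ k ∈ Finset.range N, ((k : ℝ) - β * m) ^ 2 * c k) / (ε * m) ^ 2 ≤ p ^ m / 2 := by
    rw [div_le_iff₀ (by positivity)]
    refine hsum.trans ?_
    rw [div_lt_iff₀ (by positivity)] at hMm
    have : 0 ≤ p ^ m * m * (m * ε ^ 2 - 2 * g) :=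
      mul_nonneg (by positivity) (by linarith)
    nlinarith
  have h4 : (N : ℝ) * (p ^ m / (2 * N)) = p ^ m / 2 := by field_simp
  linarith

set_option maxHeartbeats 1000000 in
/-- Along some exponent the coefficient has at least the claimed exponential growth rate. -/
lemma exists_coeff_pow_large {P : ℝ[X]} (hP : ∀ n, 0 ≤ P.coeff n) (h0 : 1 ≤ P.coeff 0)
    {d : ℕ} (hd : 1 ≤ P.coeff d) {z β : ℝ} (hz : 0 < z) (hβ : (euler P).eval z = β * P.eval z)
    (hβ0 : 0 < β) (hβd : β < d) {a b : ℕ} (hb : 0 < b) (hab : β * b = a) {ε : ℝ} (hε : 0 < ε) :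
    ∃ m k : ℕ, 0 < m ∧ (k : ℝ) = β * m ∧ 0 < (P ^ m).coeff k ∧
      m * (Real.log (P.eval z) - β * Real.log z - ε) ≤ Real.log ((P ^ m).coeff k) := by
  set p := P.eval z with hpdef
  have hp : 1 ≤ p := one_le_eval hP h0 hz.le
  have hlp : 0 ≤ Real.log p := Real.log_nonneg hp
  have hb' : (0 : ℝ) < b := by exact_mod_cast hb
  have hb1 : (1 : ℝ) ≤ b := by exact_mod_cast hb
  have hd0 : 0 < d := by
    have : (0 : ℝ) < d := hβ0.trans hβd
    exact_mod_cast this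
  have ha1 : (1 : ℝ) ≤ a := by
    have : (0 : ℝ) < a := by rw [← hab]; positivity
    exact_mod_cast (by exact_mod_cast this : 0 < a)
  have had : (a : ℝ) + 1 ≤ d * b := by
    have h : (a : ℝ) < d * b := by rw [← hab]; exact mul_lt_mul_of_pos_right hβd hb'
    exact_mod_cast (by exact_mod_cast h : a < d * b)
  set L := |Real.log z| with hL
  have hL0 : 0 ≤ L := abs_nonneg _
  set B := β * L + Real.log p with hB
  have hB0 : 0 ≤ B := by positivity
  -- `D` collects the three losses per unit of δm: `L` for k differing from βm, 2bB for the padding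
  -- factors, and 1 for the logarithm of the polynomial factor.
  set D := L + 2 * b * B + 1 with hD
  have hDpos : 0 < D := by positivity
  set δ := ε / D with hδ
  have hδ0 : 0 < δ := by positivity
  obtain ⟨M, hM⟩ := exists_coeff_in_window hP h0 hz hβ hδ0
  have hlog : ∀ᶠ m : ℕ in atTop,
      Real.log (2 * (m * P.natDegree + 1)) ≤ δ * m := by
    have h1 : ∀ᶠ x : ℝ in atTop, Real.log x ≤ δ / 2 * x := by
      have := Real.isLittleO_log_id_atTop.bound (half_pos hδ0)
      filter_upwards [this, eventually_ge_atTop (1 : ℝ)] with x hx hx1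
      simp only [Real.norm_eq_abs, id] at hx
      rw [abs_of_nonneg (by linarith : (0 : ℝ) ≤ x)] at hx
      exact (le_abs_self _).trans hx
    have h2 := tendsto_natCast_atTop_atTop (R := ℝ)
    have h3 : ∀ᶠ m : ℕ in atTop, Real.log (2 * (P.natDegree + 1)) ≤ δ / 2 * m :=
      (h2.const_mul_atTop (half_pos hδ0)).eventually_ge_atTop _
    filter_upwards [h2.eventually h1, h3, eventually_ge_atTop 1] with m hm1 hm2 hm3
    have hm4 : (1 : ℝ) ≤ m := by exact_mod_cast hm3
    have : Real.log (2 * (m * P.natDegree + 1)) ≤ Real.log (2 * (P.natDegree + 1) * m) := by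
      apply Real.log_le_log (by positivity)
      nlinarith
    rw [Real.log_mul (x := 2 * (P.natDegree + 1 : ℝ)) (by positivity) (by positivity)] at this
    linarith
  obtain ⟨M', hM'⟩ := eventually_atTop.1 hlog
  obtain ⟨M'', hM''⟩ := exists_nat_gt (1 / δ)
  set j := M + M' + M'' + 1 with hj
  -- A multiple of `b`, so that βm = a j is an integer.
  set m := b * j with hm
  have hjm : j ≤ m := Nat.le_mul_of_pos_left j hb
  have hm0 : (0 : ℝ) < m := by exact_mod_cast (by omega : 0 < m)
  have hone : 1 ≤ δ * m := by
    rw [div_lt_iff₀ hδ0] at hM''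
    have : (M'' : ℝ) ≤ m := by exact_mod_cast (by omega : M'' ≤ m)
    nlinarith
  obtain ⟨k, hk1, hk2⟩ := hM m (by omega)
  rw [← hpdef] at hk2
  have hlogm := hM' m (by omega)
  have hk3 := abs_le.1 hk1
  set t := ⌈δ * m⌉₊ with ht
  have ht1 : δ * m ≤ t := Nat.le_ceil _
  have ht2 : (t : ℝ) ≤ 2 * (δ * m) := by
    have := Nat.ceil_lt_add_one (a := δ * m) (by positivity)
    linarith
  have hβm : β * m = a * j := by rw [hm, ← hab]; push_cast; ring
  have hkle : k ≤ a * j + a * t := by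
    have : (k : ℝ) ≤ a * j + a * t := by
      have : (0 : ℝ) ≤ (a - 1) * t := mul_nonneg (by linarith) (by positivity)
      linarith
    exact_mod_cast this
  -- `J` is the correction needed after padding with b t factors, whose share of the exponent is a
  -- t. It is nonnegative because a ≥ 1 and t ≥ δm, and at most d b t because a + 1 ≤ d b.
  obtain ⟨J, hJ⟩ := Nat.exists_eq_add_of_le hkle
  have hJ' : (a : ℝ) * j + a * t = k + J := by exact_mod_cast hJ
  have hJle : J ≤ d * b * t := by
    have : (J : ℝ) ≤ d * b * t := by
      have : (0 : ℝ) ≤ (d * b - a - 1) * t := mul_nonneg (by linarith) (by positivity)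
      linarith
    exact_mod_cast this
  have hc : 0 < (P ^ m).coeff k := by
    by_contra hcon
    have h0' : (P ^ m).coeff k = 0 := le_antisymm (not_lt.1 hcon) (coeff_pow_nonneg hP m k)
    rw [h0'] at hk2
    have : 0 < p ^ m := by positivity
    linarith
  -- Raising everything to the power `d` turns the correction into d J, a multiple of `d`, which
  -- P^(dbt) can supply from its terms X^d and 1.
  have hbig : ((P ^ m).coeff k) ^ d ≤ (P ^ (m * d + d * b * t)).coeff (k * d + d * J) := by
    have h1 := pow_coeff_le_coeff_pow_mul hP m k d
    have h2 := one_le_coeff_pow_mul hP h0 hd hJle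
    have h3 := coeff_pow_supermul hP (m * d) (d * b * t) (k * d) (d * J)
    have h4 : 0 ≤ (P ^ (m * d)).coeff (k * d) := coeff_pow_nonneg hP _ _
    nlinarith
  have hcd : 0 < ((P ^ m).coeff k) ^ d := by positivity
  refine ⟨m * d + d * b * t, k * d + d * J, by positivity, ?_, hcd.trans_le hbig, ?_⟩
  · push_cast
    have : (b : ℝ) * β = a := by rw [← hab]; ring
    calc (k : ℝ) * d + d * J = d * (k + J) := by ring
      _ = d * (a * j + a * t) := by rw [hJ']
      _ = d * (β * m) + d * (b * β * t) := by rw [hβm, this]; ring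
      _ = _ := by ring
  · refine le_trans ?_ (Real.log_le_log hcd hbig)
    rw [Real.log_pow]
    have hpm : 0 < p ^ m := pow_pos (by linarith) m
    have hzk : 0 < z ^ k := pow_pos hz k
    have hN : (0 : ℝ) < 2 * (m * P.natDegree + 1) := by positivity
    have hlk := Real.log_le_log hpm hk2
    rw [Real.log_mul hN.ne' (mul_pos hc hzk).ne', Real.log_mul hc.ne' hzk.ne',
      Real.log_pow, Real.log_pow] at hlk
    have hz1 : (k - β * m) * Real.log z ≤ δ * m * L := by
      refine (le_abs_self _).trans ?_
      rw [abs_mul]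
      exact mul_le_mul_of_nonneg_right hk1 hL0
    have hz2 : -β * Real.log z ≤ β * L := by
      have := neg_abs_le (Real.log z)
      nlinarith
    have hz3 : (b : ℝ) * t * (Real.log p - β * Real.log z) ≤ b * (2 * (δ * m)) * B := by
      have h1 : Real.log p - β * Real.log z ≤ B := by rw [hB]; linarith
      calc (b : ℝ) * t * (Real.log p - β * Real.log z) ≤ b * t * B :=
            mul_le_mul_of_nonneg_left h1 (by positivity)
        _ ≤ _ := by gcongr
    have hδD : δ * m * D = ε * m := by rw [hδ]; field_simp
    have hmain : (m + b * t : ℝ) * (Real.log p - β * Real.log z - ε) ≤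
        Real.log ((P ^ m).coeff k) := by
      have h5 : 0 ≤ (b : ℝ) * t * ε := by positivity
      have h6 : δ * m * D = δ * m * L + b * (2 * (δ * m)) * B + δ * m := by rw [hD]; ring
      nlinarith
    push_cast
    calc ((m : ℝ) * d + d * b * t) * (Real.log p - β * Real.log z - ε)
        = d * ((m + b * t : ℝ) * (Real.log p - β * Real.log z - ε)) := by ring
      _ ≤ _ := mul_le_mul_of_nonneg_left hmain (by positivity)

/-- Supermultiplicativity turns the growth rate along one exponent into a lower bound along all. -/
lemma log_coeff_pow_ge {P : ℝ[X]} (hP : ∀ n, 0 ≤ P.coeff n) {β y : ℝ} {m₀ k₀ : ℕ} (hm₀ : 0 < m₀)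
    (hk₀ : (k₀ : ℝ) = β * m₀) (hc₀ : 0 < (P ^ m₀).coeff k₀)
    (hy : m₀ * y ≤ Real.log ((P ^ m₀).coeff k₀)) :
    ∃ C : ℝ, ∀ m k : ℕ, (k : ℝ) = β * m → 0 < (P ^ m).coeff k →
      m * y - C ≤ Real.log ((P ^ m).coeff k) := by
  classical
  have hres : ∀ r : ℕ, ∃ C : ℝ, 0 ≤ C ∧ ∀ m k : ℕ, m % m₀ = r → (k : ℝ) = β * m →
      0 < (P ^ m).coeff k → m * y - C ≤ Real.log ((P ^ m).coeff k) := by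
    intro r
    -- In each residue class modulo `m₀`, compare with the least exponent having a positive
    -- coefficient: every later one exceeds it by t copies of `m₀`. A class without such exponents
    -- imposes nothing.
    by_cases hex : ∃ m, m % m₀ = r ∧ ∃ k : ℕ, (k : ℝ) = β * m ∧ 0 < (P ^ m).coeff k
    · obtain ⟨hn1, l, hl, hcl⟩ := Nat.find_spec hex
      set n := Nat.find hex
      refine ⟨|n * y - Real.log ((P ^ n).coeff l)|, abs_nonneg _, fun m k hmr hk hc => ?_⟩
      have hnm : n ≤ m := Nat.find_min' hex ⟨hmr, k, hk, hc⟩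
      obtain ⟨t, ht⟩ := (Nat.modEq_iff_dvd' hnm).1 (hn1.trans hmr.symm)
      have hm : m = m₀ * t + n := by omega
      have hk' : k = k₀ * t + l := by
        have : (k : ℝ) = k₀ * t + l := by rw [hk, hm, hk₀, hl]; push_cast; ring
        exact_mod_cast this
      have h1 := pow_coeff_le_coeff_pow_mul hP m₀ k₀ t
      have h2 := coeff_pow_supermul hP (m₀ * t) n (k₀ * t) l
      rw [← hm, ← hk'] at h2
      have h3 := Real.log_le_log (by positivity) ((mul_le_mul_of_nonneg_right h1 hcl.le).trans h2)
      rw [Real.log_mul (by positivity) hcl.ne', Real.log_pow] at h3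
      have h4 := mul_le_mul_of_nonneg_left hy (Nat.cast_nonneg (α := ℝ) t)
      have h5 := le_abs_self (n * y - Real.log ((P ^ n).coeff l))
      have h6 : (m : ℝ) = m₀ * t + n := by exact_mod_cast hm
      rw [h6]
      linarith
    · push Not at hex
      exact ⟨0, le_rfl, fun m k hm hk hc => absurd hc (not_lt.2 (hex m hm k hk))⟩
  choose C hC0 hC using hres
  refine ⟨∑ r ∈ Finset.range m₀, C r, fun m k hk hc => ?_⟩
  have h1 := hC (m % m₀) m k rfl hk hc
  have h2 : C (m % m₀) ≤ ∑ r ∈ Finset.range m₀, C r :=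
    Finset.single_le_sum (fun r _ => hC0 r) (Finset.mem_range.2 (Nat.mod_lt _ hm₀))
  linarith

/-- Exponential growth rate of the coefficients `[X ^ (β m)] P ^ m` at the saddle point `z`. -/
theorem tendsto_log_coeff_pow {P : ℝ[X]} (hP : ∀ n, 0 ≤ P.coeff n) (h0 : 1 ≤ P.coeff 0)
    {d : ℕ} (hd : 1 ≤ P.coeff d) {z β : ℝ} (hz : 0 < z) (hβ : (euler P).eval z = β * P.eval z)
    (hβ0 : 0 < β) (hβd : β < d) {a b : ℕ} (hb : 0 < b) (hab : β * b = a)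
    {ι : Type*} {l : Filter ι} {m k : ι → ℕ} (hm : Tendsto m l atTop)
    (hk : ∀ᶠ i in l, (k i : ℝ) = β * m i ∧ 0 < (P ^ m i).coeff (k i)) :
    Tendsto (fun i => Real.log ((P ^ m i).coeff (k i)) / m i) l
      (𝓝 (Real.log (P.eval z) - β * Real.log z)) := by
  have hm' : Tendsto (fun i => (m i : ℝ)) l atTop := tendsto_natCast_atTop_atTop.comp hm
  rw [tendsto_order]
  constructor
  · intro x hx
    set L := Real.log (P.eval z) - β * Real.log z
    -- Half of the gap L - x is spent on ε; the other half absorbs the constant `C` for large m.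
    obtain ⟨m₀, k₀, hm₀, hk₀, hc₀, hy⟩ := exists_coeff_pow_large hP h0 hd hz hβ hβ0 hβd hb hab
      (ε := (L - x) / 2) (by linarith)
    obtain ⟨C, hC⟩ := log_coeff_pow_ge hP hm₀ hk₀ hc₀ hy
    have h1 : ∀ᶠ i in l, C < (L - x) / 2 * m i :=
      (hm'.const_mul_atTop (by linarith : 0 < (L - x) / 2)).eventually_gt_atTop C
    filter_upwards [hk, h1, hm'.eventually_gt_atTop 0] with i hi hCi hi0
    rw [lt_div_iff₀ hi0]
    have := hC _ _ hi.1 hi.2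
    nlinarith
  · intro x hx
    filter_upwards [hk, hm'.eventually_gt_atTop 0] with i hi hi0
    refine lt_of_le_of_lt ?_ hx
    rw [div_le_iff₀ hi0]
    have := log_coeff_pow_le hP hz hi.2
    rw [hi.1] at this
    linarith

/-! ### The saddle-point equation -/

/-- Mean of the tilted distribution is strictly increasing in the tilt, cross-multiplied. -/
lemma euler_cross_lt {P : ℝ[X]} (hP : ∀ n, 0 ≤ P.coeff n) (h0 : 0 < P.coeff 0) {d : ℕ}
    (hd0 : 0 < d) (hd : 0 < P.coeff d) {x y : ℝ} (hx : 0 ≤ x) (hxy : x < y) :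
    (euler P).eval x * P.eval y < (euler P).eval y * P.eval x := by
  set N := P.natDegree + 1 with hN
  have hNd : P.natDegree < N := lt_add_one _
  have hdN : d ∈ Finset.range N :=
    Finset.mem_range.2 (Nat.lt_succ_of_le (le_natDegree_of_ne_zero hd.ne'))
  -- Symmetrizing the double sum in u and v makes each term nonnegative: both factors change sign
  -- together. The pair (d, 0) supplies strictness.
  set T : ℕ → ℕ → ℝ := fun u v =>
    P.coeff u * P.coeff v * (((u : ℝ) - v) * (y ^ u * x ^ v - x ^ u * y ^ v)) with hT
  have e1 : (euler P).eval y * P.eval x - (euler P).eval x * P.eval y =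
      ∑ u ∈ Finset.range N, ∑ v ∈ Finset.range N,
        P.coeff u * P.coeff v * ((u : ℝ) * (y ^ u * x ^ v - x ^ u * y ^ v)) := by
    rw [eval_euler_eq_sum P hNd, eval_euler_eq_sum P hNd, eval_eq_sum_lt P hNd,
      eval_eq_sum_lt P hNd, Finset.sum_mul_sum, Finset.sum_mul_sum, ← Finset.sum_sub_distrib]
    refine Finset.sum_congr rfl fun u _ => ?_
    rw [← Finset.sum_sub_distrib]
    exact Finset.sum_congr rfl fun v _ => by ring
  have e2 : 2 * ((euler P).eval y * P.eval x - (euler P).eval x * P.eval y) =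
      ∑ u ∈ Finset.range N, ∑ v ∈ Finset.range N, T u v := by
    have e3 := e1.trans Finset.sum_comm
    rw [two_mul]
    nth_rewrite 2 [e3]
    rw [e1, ← Finset.sum_add_distrib]
    refine Finset.sum_congr rfl fun u _ => ?_
    rw [← Finset.sum_add_distrib]
    exact Finset.sum_congr rfl fun v _ => by simp only [hT]; ring
  have hT0 : ∀ u v, 0 ≤ T u v := by
    have hy : 0 ≤ y := hx.trans hxy.le
    have key : ∀ u v : ℕ, v ≤ u → 0 ≤ y ^ u * x ^ v - x ^ u * y ^ v := by
      intro u v huv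
      obtain ⟨i, rfl⟩ := Nat.exists_eq_add_of_le huv
      have h1 : x ^ i ≤ y ^ i := pow_le_pow_left₀ hx hxy.le i
      have h2 : 0 ≤ x ^ v * y ^ v * (y ^ i - x ^ i) :=
        mul_nonneg (by positivity) (by linarith)
      rw [pow_add, pow_add]
      linarith
    intro u v
    refine mul_nonneg (mul_nonneg (hP u) (hP v)) ?_
    rcases le_total v u with h | h
    · have : (v : ℝ) ≤ u := by exact_mod_cast h
      exact mul_nonneg (by linarith) (key u v h)
    · have h1 : (u : ℝ) ≤ v := by exact_mod_cast h
      have h2 := key v u h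
      exact mul_nonneg_of_nonpos_of_nonpos (by linarith) (by linarith)
  have hpos : 0 < T d 0 := by
    have : x ^ d < y ^ d := pow_lt_pow_left₀ hxy hx hd0.ne'
    have hd1 : (0 : ℝ) < d := by exact_mod_cast hd0
    simp only [hT, pow_zero, mul_one, Nat.cast_zero, sub_zero]
    have : 0 < y ^ d - x ^ d := by linarith
    positivity
  have hsum : 0 < ∑ u ∈ Finset.range N, ∑ v ∈ Finset.range N, T u v :=
    Finset.sum_pos' (fun u _ => Finset.sum_nonneg fun v _ => hT0 u v)
      ⟨d, hdN, Finset.sum_pos' (fun v _ => hT0 d v)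
        ⟨0, Finset.mem_range.2 (Nat.succ_pos _), hpos⟩⟩
  linarith

/-- The mean is below `d` because the constant term has positive mass; this is why ū/s is not
attained. -/
lemma eval_euler_lt {P : ℝ[X]} (hP : ∀ n, 0 ≤ P.coeff n) (h0 : 0 < P.coeff 0) {d : ℕ}
    (hd0 : 0 < d) (hd : P.natDegree ≤ d) {z : ℝ} (hz : 0 ≤ z) :
    (euler P).eval z < d * P.eval z := by
  have hN : P.natDegree < d + 1 := by omega
  rw [eval_euler_eq_sum P hN, eval_eq_sum_lt P hN, Finset.mul_sum]
  refine Finset.sum_lt_sum (fun k hk => ?_) ⟨0, by simp, ?_⟩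
  · have : (k : ℝ) ≤ d := by exact_mod_cast Nat.lt_succ_iff.1 (Finset.mem_range.1 hk)
    exact mul_le_mul_of_nonneg_right this (mul_nonneg (hP k) (pow_nonneg hz k))
  · have hd1 : (0 : ℝ) < d := by exact_mod_cast hd0
    simp only [pow_zero, mul_one, Nat.cast_zero, zero_mul]
    positivity

/-- The saddle-point equation `z P'(z) = β P(z)` is solvable for `0 ≤ β < deg P`. -/
lemma exists_eval_euler_eq {P : ℝ[X]} (hP : ∀ n, 0 ≤ P.coeff n) {d : ℕ} (hd : P.natDegree = d)
    (hd0 : 0 < d) {β : ℝ} (hβ0 : 0 ≤ β) (hβd : β < d) :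
    ∃ z, 0 ≤ z ∧ (euler P).eval z = β * P.eval z := by
  -- The coefficients of `Q` are (n - β) P_n, so Q(0) ≤ 0 and the leading coefficient is positive:
  -- the intermediate value theorem gives a root.
  set Q : ℝ[X] := euler P - C β * P with hQ
  have hP0 : P ≠ 0 := by rintro rfl; simp at hd; omega
  have hlead : 0 < P.coeff d := by
    refine lt_of_le_of_ne (hP d) (Ne.symm ?_)
    rw [← hd]
    exact leadingCoeff_ne_zero.2 hP0
  have hQc : ∀ n, Q.coeff n = (n - β) * P.coeff n := by
    intro n; rw [hQ, coeff_sub, coeff_euler, coeff_C_mul]; ring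
  have hQd : 0 < Q.coeff d := by rw [hQc]; exact mul_pos (by linarith) hlead
  have hQdeg : Q.natDegree = d := by
    refine le_antisymm ?_ (le_natDegree_of_ne_zero hQd.ne')
    rw [natDegree_le_iff_coeff_eq_zero]
    intro n hn
    rw [hQc, coeff_eq_zero_of_natDegree_lt (by omega), mul_zero]
  have htend := Q.tendsto_atTop_of_leadingCoeff_nonneg
    (natDegree_pos_iff_degree_pos.1 (by omega)) (by rw [leadingCoeff, hQdeg]; exact hQd.le)
  obtain ⟨y, hy, hy0⟩ := ((htend.eventually_ge_atTop 0).and (eventually_ge_atTop 0)).exists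
  have hQ0 : Q.eval 0 ≤ 0 := by
    rw [← coeff_zero_eq_eval_zero, hQc]
    have := hP 0
    push_cast
    nlinarith
  obtain ⟨z, hz, hzQ⟩ := intermediate_value_Icc hy0 Q.continuous.continuousOn ⟨hQ0, hy⟩
  refine ⟨z, hz.1, ?_⟩
  simp only [hQ, eval_sub, eval_mul, eval_C] at hzQ
  linarith

/-! ### The weight enumerating function and the bijection f -/

section Wef

variable {s : ℕ} (K : LinCode s)

lemma coeff_wef (u : ℕ) : (wef K).coeff u = weightCount K u := by
  rw [wef, finsetSum_coeff]
  simp only [coeff_monomial]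
  rw [Finset.sum_ite_eq' (Finset.range (s + 1)) u]
  split_ifs with h
  · rfl
  · symm
    rw [Nat.cast_eq_zero, weightCount, Set.ncard_eq_zero, Set.eq_empty_iff_forall_notMem]
    rintro c ⟨-, hc⟩
    have := hammingNorm_le_card_fintype (x := c)
    rw [Fintype.card_fin] at this
    rw [Finset.mem_range] at h
    omega

lemma coeff_wef_nonneg (u : ℕ) : 0 ≤ (wef K).coeff u := by
  rw [coeff_wef]; positivity

lemma coeff_wef_zero : (wef K).coeff 0 = 1 := by
  rw [coeff_wef, weightCount]
  have : {c : Fin s → ZMod 2 | c ∈ K ∧ hammingNorm c = 0} = {0} := by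
    ext c
    simp only [hammingNorm_eq_zero, Set.mem_ofPred_eq, Set.mem_singleton_iff]
    exact ⟨fun h => h.2, fun h => ⟨h ▸ K.zero_mem, h⟩⟩
  rw [this, Set.ncard_singleton, Nat.cast_one]

lemma weightCount_pos_iff (u : ℕ) : 0 < weightCount K u ↔ ∃ c ∈ K, hammingNorm c = u := by
  rw [weightCount, Set.ncard_pos]
  exact Iff.rfl

lemma mem_Icc_minDist {u : ℕ} (hu : 0 < u) (h : 0 < weightCount K u) :
    u ∈ Finset.Icc (minDist K) s := by
  obtain ⟨c, hc, rfl⟩ := (weightCount_pos_iff K u).1 h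
  have h1 := hammingNorm_le_card_fintype (x := c)
  rw [Fintype.card_fin] at h1
  exact Finset.mem_Icc.2 ⟨Nat.sInf_le ⟨c, hc, hammingNorm_pos_iff.1 hu, rfl⟩, h1⟩

variable {K} (hK : K ≠ ⊥)
include hK

/-- A nonzero codeword makes the defining set nonempty and `s` bounds it, so the supremum is
attained and is not a default value. -/
lemma maxWeight_spec : 0 < maxWeight K ∧ maxWeight K ≤ s ∧ 0 < weightCount K (maxWeight K) ∧
    (wef K).natDegree = maxWeight K := by
  obtain ⟨c, hc, hc0⟩ := Submodule.exists_mem_ne_zero_of_ne_bot hK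
  have hcpos : 0 < hammingNorm c := hammingNorm_pos_iff.2 hc0
  have hcw : 0 < weightCount K (hammingNorm c) := (weightCount_pos_iff K _).2 ⟨c, hc, rfl⟩
  set S := {u : ℕ | u ∈ Finset.Icc (minDist K) s ∧ 0 < weightCount K u} with hS
  have hbdd : BddAbove S := ⟨s, fun u hu => (Finset.mem_Icc.1 hu.1).2⟩
  have hmem : hammingNorm c ∈ S := ⟨mem_Icc_minDist K hcpos hcw, hcw⟩
  have hsup : maxWeight K ∈ S := Nat.sSup_mem ⟨_, hmem⟩ hbdd
  have hpos : 0 < maxWeight K := hcpos.trans_le (le_csSup hbdd hmem)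
  refine ⟨hpos, (Finset.mem_Icc.1 hsup.1).2, hsup.2, le_antisymm ?_ ?_⟩
  · rw [natDegree_le_iff_coeff_eq_zero]
    intro n hn
    rw [coeff_wef, Nat.cast_eq_zero]
    by_contra h
    have hn' := Nat.pos_of_ne_zero h
    exact absurd (le_csSup hbdd ⟨mem_Icc_minDist K (hpos.trans hn) hn', hn'⟩ : n ≤ maxWeight K)
      (not_le.2 hn)
  · apply le_natDegree_of_ne_zero
    rw [coeff_wef]
    exact_mod_cast hsup.2.ne'

lemma length_pos : 0 < s := (maxWeight_spec hK).1.trans_le (maxWeight_spec hK).2.1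

omit hK in
lemma one_le_eval_wef {z : ℝ} (hz : 0 ≤ z) : 1 ≤ (wef K).eval z :=
  one_le_eval (coeff_wef_nonneg K) (coeff_wef_zero K).ge hz

omit hK in
lemma f_eq (z : ℝ) : f K z = (euler (wef K)).eval z / (s * (wef K).eval z) := by
  rw [f, euler, eval_mul, eval_X]

/-- `f` is a bijection from `[0, ∞)` onto `[0, ū / s)`. -/
theorem bijOn_f : Set.BijOn (f K) (Set.Ici 0) (Set.Ico 0 ((maxWeight K : ℝ) / s)) := by
  obtain ⟨hpos, -, hcount, hdeg⟩ := maxWeight_spec hK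
  have hs : (0 : ℝ) < s := by exact_mod_cast length_pos hK
  have hA : ∀ z, 0 ≤ z → 0 < (wef K).eval z := fun z hz => by
    linarith [one_le_eval_wef (K := K) hz]
  have hnn := coeff_wef_nonneg K
  have h0 : 0 < (wef K).coeff 0 := by rw [coeff_wef_zero]; norm_num
  have hd : 0 < (wef K).coeff (maxWeight K) := by rw [coeff_wef]; exact_mod_cast hcount
  have hmono : StrictMonoOn (f K) (Set.Ici 0) := by
    intro x hx y hy hxy
    have hx' := hA x hx
    have hy' := hA y hy
    rw [f_eq, f_eq, div_lt_div_iff₀ (by positivity) (by positivity)]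
    nlinarith [euler_cross_lt hnn h0 hpos hd (Set.mem_Ici.1 hx) hxy]
  refine ⟨fun z hz => ⟨?_, ?_⟩, hmono.injOn, fun α hα => ?_⟩
  · rw [f_eq, eval_euler_eq_sum _ (lt_add_one _)]
    have := hA z hz
    have hz' : 0 ≤ z := hz
    refine div_nonneg (Finset.sum_nonneg fun k _ => ?_) (by positivity)
    have := hnn k
    positivity
  · have := hA z hz
    rw [f_eq, div_lt_div_iff₀ (by positivity) hs]
    nlinarith [eval_euler_lt hnn h0 hpos hdeg.le (Set.mem_Ici.1 hz)]
  · have h2 := hα.2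
    rw [lt_div_iff₀ hs] at h2
    obtain ⟨z, hz, hze⟩ := exists_eval_euler_eq hnn hdeg hpos (mul_nonneg hα.1 hs.le) h2
    refine ⟨z, hz, ?_⟩
    have := hA z hz
    rw [f_eq, hze]
    field_simp

lemma fInv_spec {α : ℝ} (hα0 : 0 ≤ α) (hα : α < (maxWeight K : ℝ) / s) :
    0 ≤ fInv K α ∧ (euler (wef K)).eval (fInv K α) = α * s * (wef K).eval (fInv K α) := by
  have hex := (bijOn_f hK).surjOn ⟨hα0, hα⟩
  have h1 := Function.invFunOn_mem hex
  have h2 := Function.invFunOn_eq hex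
  refine ⟨h1, ?_⟩
  change f K (fInv K α) = α at h2
  have h3 := one_le_eval_wef (K := K) (z := fInv K α) h1
  have hs : (0 : ℝ) < s := by exact_mod_cast length_pos hK
  rw [f_eq, div_eq_iff (by positivity)] at h2
  linarith

lemma fInv_zero : fInv K 0 = 0 := by
  have h : f K 0 = 0 := by simp [f]
  have := (bijOn_f hK).injOn.leftInvOn_invFunOn (Set.mem_Ici.2 (le_refl (0 : ℝ)))
  rw [h] at this
  exact this

lemma fInv_pos {α : ℝ} (hα0 : 0 < α) (hα : α < (maxWeight K : ℝ) / s) : 0 < fInv K α := by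
  obtain ⟨h1, h2⟩ := fInv_spec hK hα0.le hα
  refine lt_of_le_of_ne h1 fun h => ?_
  have h3 := one_le_eval_wef (K := K) h1
  have hs : (0 : ℝ) < s := by exact_mod_cast length_pos hK
  have h4 : (euler (wef K)).eval (fInv K α) = 0 := by rw [← h]; simp [euler]
  rw [h4] at h2
  have : 0 < α * s * (wef K).eval (fInv K α) := by positivity
  linarith

end Wef

/-! ### Counting Tanner graphs and the expected weight enumerator -/

/-- Number of bijections carrying one binary labelling to another of the same weight. -/
lemma card_equiv_comp_eq {α β γ : Type*} [Fintype α] [Fintype β] [DecidableEq α] [DecidableEq β]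
    [DecidableEq γ] [Fintype γ] (y : α → γ) (v : β → γ)
    (h : ∀ c, Fintype.card {a // y a = c} = Fintype.card {b // v b = c}) :
    Fintype.card {e : α ≃ β // v ∘ e = y} = ∏ c, (Fintype.card {a // y a = c}).factorial := by
  rw [← DomMulAct.stabilizer_card y]
  -- Composition with one fixed label-preserving bijection identifies the set with the stabilizer of
  -- `y`.
  let e₀ : α ≃ β := Equiv.ofFiberEquiv (f := y) (g := v) fun c => Fintype.equivOfCardEq (h c)
  have he₀ : ∀ a, v (e₀ a) = y a := fun a => Equiv.ofFiberEquiv_map _ a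
  refine Fintype.card_congr ⟨fun e => ⟨e.1.trans e₀.symm, ?_⟩, fun g => ⟨g.1.trans e₀, ?_⟩, ?_, ?_⟩
  · funext a
    have := congrFun e.2 a
    simp only [Function.comp_apply, Equiv.trans_apply] at this ⊢
    rw [← he₀, Equiv.apply_symm_apply, this]
  · funext a
    have := congrFun g.2 a
    simp only [Function.comp_apply, Equiv.trans_apply] at this ⊢
    rw [he₀, this]
  · intro e; ext a; simp
  · intro g; ext a; simp

lemma card_fiber_one {α : Type*} [Fintype α] (y : α → ZMod 2) :
    Fintype.card {a // y a = 1} = hammingNorm y := by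
  rw [Fintype.card_subtype, hammingNorm]
  congr 1
  ext a
  simp only [Finset.mem_filter, Finset.mem_univ, true_and]
  generalize y a = t
  revert t; decide

lemma card_fiber_zero {α : Type*} [Fintype α] (y : α → ZMod 2) :
    Fintype.card {a // y a = 0} = Fintype.card α - hammingNorm y := by
  have h := Fintype.card_subtype_compl (fun a => y a = 0)
  have h2 : Fintype.card {a // ¬ y a = 0} = hammingNorm y := by
    rw [Fintype.card_subtype]; rfl
  have h3 := Fintype.card_subtype_le (fun a => y a = 0)
  omega

lemma card_equiv_comp_eq_binary {α β : Type*} [Fintype α] [Fintype β] [DecidableEq α]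
    [DecidableEq β] (y : α → ZMod 2) (v : β → ZMod 2) (hαβ : Fintype.card α = Fintype.card β)
    (h : hammingNorm y = hammingNorm v) :
    Fintype.card {e : α ≃ β // v ∘ e = y} =
      (hammingNorm y).factorial * (Fintype.card α - hammingNorm y).factorial := by
  rw [card_equiv_comp_eq y v]
  · have : (Finset.univ : Finset (ZMod 2)) = {0, 1} := rfl
    rw [this, Finset.prod_insert (by decide), Finset.prod_singleton, card_fiber_zero,
      card_fiber_one, mul_comm]
  · intro c
    have hc : c = 0 ∨ c = 1 := by revert c; decide
    rcases hc with rfl | rfl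
    · rw [card_fiber_zero, card_fiber_zero, hαβ, h]
    · rw [card_fiber_one, card_fiber_one, h]

lemma hammingNorm_comp_equiv {α β : Type*} [Fintype α] [Fintype β] (e : α ≃ β)
    (v : β → ZMod 2) : hammingNorm (v ∘ e) = hammingNorm v := by
  rw [← card_fiber_one, ← card_fiber_one]
  exact Fintype.card_congr (e.subtypeEquiv fun a => Iff.rfl)

lemma card_hammingNorm_eq {α : Type*} [Fintype α] [DecidableEq α] (w : ℕ) :
    Fintype.card {x : α → ZMod 2 // hammingNorm x = w} = (Fintype.card α).choose w := by
  classical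
  rw [Fintype.card_subtype, ← Finset.card_univ, ← Finset.card_powersetCard]
  refine Finset.card_bij' (fun x _ => Finset.univ.filter fun a => x a ≠ 0)
    (fun s _ a => if a ∈ s then 1 else 0) ?_ ?_ ?_ ?_
  · intro x hx
    simpa [Finset.mem_powersetCard, hammingNorm] using hx
  · intro s hs
    simpa [Finset.mem_powersetCard, hammingNorm] using hs
  · intro x _
    funext a
    simp only [Finset.mem_filter, Finset.mem_univ, true_and]
    generalize x a = t
    revert t; decide
  · intro s _
    ext a; simp

lemma hammingNorm_prod {α β : Type*} [Fintype α] [Fintype β] (v : α × β → ZMod 2) :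
    hammingNorm v = ∑ a, hammingNorm fun b => v (a, b) := by
  simp only [hammingNorm, Finset.card_filter]
  rw [Fintype.sum_prod_type]

lemma hammingNorm_repeat {n q : ℕ} (x : Fin n → ZMod 2) :
    hammingNorm (fun p : Fin n × Fin q => x p.1) = hammingNorm x * q := by
  rw [hammingNorm_prod]
  have : ∀ a, (hammingNorm fun _ : Fin q => x a) = (if x a ≠ 0 then 1 else 0) * q := by
    intro a
    by_cases h : x a = 0 <;> simp [hammingNorm, h]
  simp only [this]
  rw [← Finset.sum_mul, hammingNorm, Finset.card_filter]

lemma weightCount_eq_card {s : ℕ} (K : LinCode s) (u : ℕ) [DecidablePred (· ∈ K)] :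
    weightCount K u = (Finset.univ.filter fun c => c ∈ K ∧ hammingNorm c = u).card := by
  rw [weightCount, ← Set.ncard_coe_finset]
  congr 1; ext c; simp

lemma wef_eq_sum {s : ℕ} (K : LinCode s) [DecidablePred (· ∈ K)] :
    wef K = ∑ c ∈ Finset.univ.filter (· ∈ K), (X : ℝ[X]) ^ hammingNorm c := by
  have hmaps : ∀ c ∈ Finset.univ.filter (· ∈ K), hammingNorm c ∈ Finset.range (s + 1) := by
    intro c _
    have := hammingNorm_le_card_fintype (x := c)
    simp only [Fintype.card_fin] at this
    exact Finset.mem_range.2 (by omega)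
  rw [wef, ← Finset.sum_fiberwise_of_maps_to hmaps]
  refine Finset.sum_congr rfl fun u _ => ?_
  rw [Finset.sum_congr rfl (g := fun _ => X ^ u) (by
    intro c hc; rw [(Finset.mem_filter.1 hc).2])]
  rw [Finset.sum_const, Finset.filter_filter, ← weightCount_eq_card, ← C_mul_X_pow_eq_monomial]
  simp

/-- `[X ^ k] A ^ m` counts the words of weight `k` in the `m`-fold product of `K`. -/
lemma coeff_wef_pow {s : ℕ} (K : LinCode s) [DecidablePred (· ∈ K)] (m k : ℕ) :
    ((wef K) ^ m).coeff k =
      Fintype.card {v : Fin m × Fin s → ZMod 2 //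
        (∀ j, (fun b => v (j, b)) ∈ K) ∧ hammingNorm v = k} := by
  have h1 : (wef K) ^ m = ∑ v ∈ Fintype.piFinset fun _ : Fin m => Finset.univ.filter (· ∈ K),
      (X : ℝ[X]) ^ ∑ j, hammingNorm (v j) := by
    rw [wef_eq_sum K, ← Fin.prod_const, Finset.prod_univ_sum]
    exact Finset.sum_congr rfl fun v _ => Finset.prod_pow_eq_pow_sum _ _ _
  rw [h1, finsetSum_coeff]
  simp only [coeff_X_pow]
  rw [Finset.sum_boole, Fintype.card_subtype]
  norm_cast
  refine Finset.card_equiv (Equiv.curry (Fin m) (Fin s) (ZMod 2)).symm fun v => ?_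
  simp only [Finset.mem_filter, Fintype.mem_piFinset, Finset.mem_univ, true_and,
    hammingNorm_prod, eq_comm (a := k)]
  rfl

/-- The expected weight enumerator of the ensemble. -/
theorem expectedCount_eq {s : ℕ} (K : LinCode s) {q n w : ℕ} (hdvd : s ∣ n * q) (hw : w ≤ n) :
    expectedCount K q n w =
      n.choose w * ((wef K) ^ (n * q / s)).coeff (w * q) / (n * q).choose (w * q) := by
  classical
  set m := n * q / s with hm
  have hms : m * s = n * q := Nat.div_mul_cancel hdvd
  have hwq : w * q ≤ n * q := Nat.mul_le_mul_right q hw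
  have hcardα : Fintype.card (Fin n × Fin q) = n * q := by simp
  have hcardβ : Fintype.card (Fin n × Fin q) = Fintype.card (Fin m × Fin s) := by simp [hms]
  have hgraph : Fintype.card (TannerGraph s q n) = (n * q).factorial := by
    have h := Fintype.card_equiv (Fintype.equivOfCardEq hcardβ)
    rw [hcardα] at h
    exact h
  let V := {v : Fin m × Fin s → ZMod 2 //
        (∀ j, (fun b => v (j, b)) ∈ K) ∧ hammingNorm v = w * q}
  let U := {x : Fin n → ZMod 2 // hammingNorm x = w}
  let T : U → V → Type := fun x v => {e : TannerGraph s q n // v.1 ∘ e = fun p => x.1 p.1}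
  have hnum : ∀ π : TannerGraph s q n, numCodewords K π w =
      Fintype.card {x : U // x.1 ∈ tannerCode K π} := by
    intro π
    rw [numCodewords, ← Nat.card_coe_set_eq, ← Nat.card_eq_fintype_card]
    exact Nat.card_congr ⟨fun x => ⟨⟨x.1, x.2.2⟩, x.2.1⟩, fun x => ⟨x.1.1, x.2, x.1.2⟩,
      fun _ => rfl, fun _ => rfl⟩
  -- Double counting: a graph with a codeword x of weight w is the same as x, a check-side word v
  -- built from codewords of `K`, and a bijection matching their labels. The number of such
  -- bijections depends only on the weight.
  have hequiv : (Σ π : TannerGraph s q n, {x : U // x.1 ∈ tannerCode K π}) ≃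
      Σ p : U × V, T p.1 p.2 :=
    { toFun := fun y => ⟨⟨y.2.1, ⟨fun b => y.2.1.1 (y.1.symm b).1, y.2.2, by
          have h := hammingNorm_comp_equiv y.1.symm fun p : Fin n × Fin q => y.2.1.1 p.1
          rw [hammingNorm_repeat, y.2.1.2] at h
          exact h⟩⟩, ⟨y.1, by funext p; simp⟩⟩
      invFun := fun y => ⟨y.2.1, ⟨y.1.1, by
          have h : ∀ b, y.1.1.1 (y.2.1.symm b).1 = y.1.2.1 b := fun b => by
            have := congrFun y.2.2 (y.2.1.symm b)
            simpa using this.symm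
          intro j
          have h2 : checkInput y.2.1 y.1.1.1 j = fun b => y.1.2.1 (j, b) := by
            funext b; exact h (j, b)
          rw [h2]; exact y.1.2.2.1 j⟩⟩
      left_inv := fun y => rfl
      right_inv := by
        rintro ⟨⟨x, v⟩, e, he⟩
        have hv : (fun b => x.1 (e.symm b).1) = v.1 := by
          funext b
          have := congrFun he (e.symm b)
          simpa using this.symm
        obtain ⟨v, hvK⟩ := v
        subst hv
        rfl }
  have hT : ∀ p : U × V, Fintype.card (T p.1 p.2) =
      (w * q).factorial * (n * q - w * q).factorial := by
    rintro ⟨x, v⟩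
    have hx : hammingNorm (fun p : Fin n × Fin q => x.1 p.1) = w * q := by
      rw [hammingNorm_repeat, x.2]
    have := card_equiv_comp_eq_binary (fun p : Fin n × Fin q => x.1 p.1) v.1 hcardβ
      (hx.trans v.2.2.symm)
    rw [hx, hcardα] at this
    exact this
  have hsum : ∑ π : TannerGraph s q n, numCodewords K π w =
      n.choose w * Fintype.card V * ((w * q).factorial * (n * q - w * q).factorial) := by
    simp only [hnum]
    rw [← Fintype.card_sigma, Fintype.card_congr hequiv, Fintype.card_sigma]
    simp only [hT]
    rw [Finset.sum_const, Finset.card_univ, Fintype.card_prod, smul_eq_mul]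
    congr 2
    have := card_hammingNorm_eq (α := Fin n) w
    rw [Fintype.card_fin] at this
    exact this
  have hsum' : ∑ π : TannerGraph s q n, (numCodewords K π w : ℝ) =
      n.choose w * Fintype.card V * ((w * q).factorial * (n * q - w * q).factorial) := by
    exact_mod_cast hsum
  rw [expectedCount, hsum', hgraph, coeff_wef_pow]
  have hf : ((n * q).factorial : ℝ) =
      (n * q).choose (w * q) * (w * q).factorial * (n * q - w * q).factorial := by
    exact_mod_cast (Nat.choose_mul_factorial_mul_factorial hwq).symm
  have h1 : ((n * q).choose (w * q) : ℝ) ≠ 0 := by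
    exact_mod_cast (Nat.choose_pos hwq).ne'
  have h2 : ((w * q).factorial : ℝ) ≠ 0 := by exact_mod_cast (Nat.factorial_pos _).ne'
  have h3 : ((n * q - w * q).factorial : ℝ) ≠ 0 := by exact_mod_cast (Nat.factorial_pos _).ne'
  rw [hf, div_eq_div_iff (by positivity) h1]
  ring

/-! ### Assembling the spectral shape -/

/-- Exponential growth rate of the binomial coefficients. -/
lemma tendsto_log_choose {α : ℝ} (hα0 : 0 < α) (hα1 : α < 1) {a b : ℕ} (hb : 0 < b)
    (hab : α * b = a) {ι : Type*} {l : Filter ι} {m k : ι → ℕ} (hm : Tendsto m l atTop)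
    (hk : ∀ᶠ i in l, (k i : ℝ) = α * m i) :
    Tendsto (fun i => Real.log ((m i).choose (k i)) / m i) l (𝓝 (Real.binEntropy α)) := by
  have hcoeff : ∀ m k : ℕ, ((1 + X : ℝ[X]) ^ m).coeff k = m.choose k :=
    fun m k => coeff_one_add_X_pow ℝ m k
  have h1 : ∀ k : ℕ, (1 + X : ℝ[X]).coeff k = (Nat.choose 1 k : ℝ) := fun k => by
    rw [← hcoeff, pow_one]
  have h1α : 0 < 1 - α := by linarith
  -- The saddle point of 1 + X, solving z/(1 + z) = α.
  have hz : 0 < α / (1 - α) := by positivity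
  have hev : (1 + X : ℝ[X]).eval (α / (1 - α)) = (1 - α)⁻¹ := by
    simp only [eval_add, eval_one, eval_X]; field_simp; ring
  have key := tendsto_log_coeff_pow (P := 1 + X) (d := 1) (β := α) (z := α / (1 - α))
    (fun n => by rw [h1]; positivity) (by rw [h1]; simp) (by rw [h1]; simp) hz
    (by rw [hev, euler]; simp; field_simp) hα0 (by simpa using hα1) hb hab hm (k := k) (by
      filter_upwards [hk] with i hi
      refine ⟨hi, ?_⟩
      rw [hcoeff]
      have : (k i : ℝ) ≤ m i := by
        rw [hi]
        have := Nat.cast_nonneg (α := ℝ) (m i)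
        nlinarith
      exact_mod_cast Nat.choose_pos (by exact_mod_cast this))
  simp only [hcoeff] at key
  convert key using 2
  rw [hev, Real.log_inv, Real.log_div hα0.ne' h1α.ne', Real.binEntropy, Real.log_inv, Real.log_inv]
  ring

section

variable {s : ℕ} {K : LinCode s} {q : ℕ} {α : ℝ}

/-- The binomial factors are positive for w ≤ n, so positivity of the expectation forces positivity
of the coefficient, as the growth theorem requires; `mem_admissible` is the converse. -/
lemma admissible_spec (hα1 : α ≤ 1) {n : ℕ} (hn : n ∈ admissible K q α) :
    0 < n ∧ s ∣ n * q ∧ ∃ w : ℕ, (w : ℝ) = α * n ∧ w ≤ n ∧ ⌊α * n⌋₊ = w ∧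
      0 < ((wef K) ^ (n * q / s)).coeff (w * q) := by
  obtain ⟨h0, h1, w, hw, hE⟩ := hn
  have hwn : w ≤ n := by
    have : (w : ℝ) ≤ n := by
      rw [hw]
      have := Nat.cast_nonneg (α := ℝ) n
      nlinarith
    exact_mod_cast this
  refine ⟨h0, h1, w, hw, hwn, by rw [← hw, Nat.floor_natCast], ?_⟩
  rw [expectedCount_eq K h1 hwn] at hE
  refine lt_of_le_of_ne (coeff_pow_nonneg (coeff_wef_nonneg K) _ _) fun h => ?_
  rw [← h] at hE
  simp at hE

lemma mem_admissible {n w : ℕ} (h0 : 0 < n) (h1 : s ∣ n * q) (hw : (w : ℝ) = α * n) (hwn : w ≤ n)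
    (hc : 0 < ((wef K) ^ (n * q / s)).coeff (w * q)) : n ∈ admissible K q α := by
  refine ⟨h0, h1, w, hw, ?_⟩
  rw [expectedCount_eq K h1 hwn]
  have h2 : (0 : ℝ) < n.choose w := by exact_mod_cast Nat.choose_pos hwn
  have h3 : (0 : ℝ) < (n * q).choose (w * q) := by
    exact_mod_cast Nat.choose_pos (Nat.mul_le_mul_right q hwn)
  positivity

lemma admissible_zero_infinite (hs : 0 < s) : (admissible K q 0).Infinite := by
  refine Set.infinite_of_injective_forall_mem (f := fun i : ℕ => s * (i + 1)) ?_ fun i => ?_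
  · intro i j hij
    have := Nat.eq_of_mul_eq_mul_left hs hij
    omega
  · refine mem_admissible (w := 0) (by positivity) ⟨(i + 1) * q, by ring⟩ (by simp)
      (Nat.zero_le _) ?_
    rw [zero_mul, coeff_zero_eq_eval_zero, eval_pow, ← coeff_zero_eq_eval_zero, coeff_wef_zero,
      one_pow]
    norm_num

lemma hasSpectralShapeAt_zero (hs : 0 < s) : HasSpectralShapeAt K q 0 0 := by
  refine ⟨admissible_zero_infinite hs, ?_⟩
  refine tendsto_const_nhds.congr' ?_
  rw [EventuallyEq, eventually_inf_principal]
  refine Eventually.of_forall fun n hn => ?_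
  rw [zero_mul, Nat.floor_zero, expectedCount_eq K hn.2.1 (Nat.zero_le _), zero_mul,
    coeff_zero_eq_eval_zero, eval_pow, ← coeff_zero_eq_eval_zero, coeff_wef_zero]
  simp

variable (hK : K ≠ ⊥)
include hK

lemma lt_one_of_lt_maxWeight_div (hα : α < (maxWeight K : ℝ) / s) : α < 1 := by
  have hs : (0 : ℝ) < s := by exact_mod_cast length_pos hK
  refine hα.trans_le ((div_le_one hs).2 ?_)
  exact_mod_cast (maxWeight_spec hK).2.1

/-- A power of the weight enumerating function with a positive coefficient in the required
proportion. -/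
lemma exists_coeff_wef_pow_pos (hα : α < (maxWeight K : ℝ) / s) {a b : ℕ}
    (hb : 0 < b) (hab : α * b = a) :
    ∃ m k : ℕ, 0 < m ∧ (k : ℝ) = α * s * m ∧ 0 < ((wef K) ^ m).coeff k := by
  -- Among b ū codewords, a s have the maximal weight and the rest vanish; a s ≤ b ū is the
  -- condition α ≤ ū/s.
  refine ⟨b * maxWeight K, a * s * maxWeight K, Nat.mul_pos hb (maxWeight_spec hK).1, ?_, ?_⟩
  · push_cast; rw [← hab]; ring
  · have hs : (0 : ℝ) < s := by exact_mod_cast length_pos hK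
    have hle : a * s ≤ b * maxWeight K := by
      rw [lt_div_iff₀ hs] at hα
      have : (a * s : ℝ) ≤ b * maxWeight K := by
        rw [← hab]
        have := Nat.cast_nonneg (α := ℝ) b
        nlinarith
      exact_mod_cast this
    have := one_le_coeff_pow_mul (coeff_wef_nonneg K) (coeff_wef_zero K).ge
      (d := maxWeight K) (by rw [coeff_wef]; exact_mod_cast (maxWeight_spec hK).2.2.1) hle
    rw [mul_comm (a * s)]
    linarith

lemma admissible_infinite (hα : α < (maxWeight K : ℝ) / s) {a b : ℕ}
    (hb : 0 < b) (hab : α * b = a) : (admissible K q α).Infinite := by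
  have hs := length_pos hK
  obtain ⟨m, k, hm, hk, hc⟩ := exists_coeff_wef_pow_pos hK hα hb hab
  -- For these n, nq/s is a multiple of `m` and wq the same multiple of `k`, so the required
  -- coefficient dominates a power of a positive one.
  have hinj : Function.Injective fun i : ℕ => s * b * m * (i + 1) := by
    intro i j hij
    have := Nat.eq_of_mul_eq_mul_left (by positivity : 0 < s * b * m) hij
    omega
  refine Set.infinite_of_injective_forall_mem hinj fun i => ?_
  have hab' : a ≤ b := by
    have h1 := lt_one_of_lt_maxWeight_div hK hα
    have : (a : ℝ) ≤ b := by
      rw [← hab]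
      have := Nat.cast_nonneg (α := ℝ) b
      nlinarith
    exact_mod_cast this
  have hdiv : s * b * m * (i + 1) * q / s = m * (b * (i + 1) * q) := by
    rw [show s * b * m * (i + 1) * q = s * (m * (b * (i + 1) * q)) by ring]
    exact Nat.mul_div_cancel_left _ hs
  have hkb : k * b = s * a * m := by
    have : (k * b : ℝ) = s * a * m := by rw [hk, ← hab]; ring
    exact_mod_cast this
  refine mem_admissible (w := s * a * m * (i + 1)) (by positivity) ⟨b * m * (i + 1) * q, by ring⟩
    (by push_cast; rw [← hab]; ring) (by gcongr) ?_
  rw [hdiv, show s * a * m * (i + 1) * q = k * (b * (i + 1) * q) by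
    rw [← hkb]; ring]
  exact (pow_pos hc _).trans_le (pow_coeff_le_coeff_pow_mul (coeff_wef_nonneg K) _ _ _)

theorem hasSpectralShapeAt_of_pos (hq : 0 < q) (hα0 : 0 < α) (hα : α < (maxWeight K : ℝ) / s)
    {a b : ℕ} (hb : 0 < b) (hab : α * b = a) :
    HasSpectralShapeAt K q α ((1 - (q : ℝ)) * Real.binEntropy α - q * α * Real.log (fInv K α) +
      q / s * Real.log ((wef K).eval (fInv K α))) := by
  refine ⟨admissible_infinite hK hα hb hab, ?_⟩
  have hs := length_pos hK
  have hs' : (0 : ℝ) < s := by exact_mod_cast hs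
  have hq' : (0 : ℝ) < q := by exact_mod_cast hq
  have hα1 := lt_one_of_lt_maxWeight_div hK hα
  set l := atTop ⊓ 𝓟 (admissible K q α) with hl
  have hn : Tendsto (fun n : ℕ => n) l atTop := tendsto_id.mono_left inf_le_left
  have hadm : ∀ᶠ n in l, n ∈ admissible K q α := by
    rw [hl, eventually_inf_principal]; exact Eventually.of_forall fun n hn => hn
  have hnq : Tendsto (fun n : ℕ => n * q) l atTop :=
    tendsto_atTop_mono (fun n => Nat.le_mul_of_pos_right n hq) hn
  have hm : Tendsto (fun n : ℕ => n * q / s) l atTop :=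
    (Nat.tendsto_div_const_atTop hs.ne').comp hnq
  have hmcast : ∀ n ∈ admissible K q α, ((n * q / s : ℕ) : ℝ) = n * q / s := by
    intro n hn
    rw [Nat.cast_div hn.2.1 hs'.ne']
    push_cast; rfl
  have hfl : ∀ n ∈ admissible K q α, (⌊α * n⌋₊ : ℝ) = α * n := by
    intro n hn
    obtain ⟨-, -, w, hw, -, hfw, -⟩ := admissible_spec hα1.le hn
    rw [hfw, hw]
  have hβ : (α * s) * b = ((a * s : ℕ) : ℝ) := by push_cast; rw [← hab]; ring
  have hβd : α * s < maxWeight K := by rwa [lt_div_iff₀ hs'] at hα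
  have t1 := tendsto_log_choose hα0 hα1 hb hab hn (k := fun n : ℕ => ⌊α * n⌋₊)
    (hadm.mono fun n hn => hfl n hn)
  have t2 := tendsto_log_choose hα0 hα1 hb hab hnq (k := fun n : ℕ => ⌊α * n⌋₊ * q)
    (hadm.mono fun n hn => by push_cast; rw [hfl n hn]; ring)
  have t3 := tendsto_log_coeff_pow (coeff_wef_nonneg K) (coeff_wef_zero K).ge
    (d := maxWeight K) (by rw [coeff_wef]; exact_mod_cast (maxWeight_spec hK).2.2.1)
    (fInv_pos hK hα0 hα) (fInv_spec hK hα0.le hα).2 (by positivity) hβd hb hβ hm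
    (k := fun n : ℕ => ⌊α * n⌋₊ * q) (hadm.mono fun n hn => by
      refine ⟨?_, ?_⟩
      · push_cast; rw [hfl n hn, hmcast n hn]; field_simp
      · obtain ⟨-, -, w, -, -, hfw, hc⟩ := admissible_spec hα1.le hn
        rw [hfw]; exact hc)
  -- The factors q and q/s change the normalizations nq and nq/s of the last two limits into n.
  have t := (t1.sub (t2.const_mul (q : ℝ))).add (t3.const_mul ((q : ℝ) / s))
  convert t.congr' ?_ using 2
  · field_simp
    ring
  · filter_upwards [hadm] with n hn
    obtain ⟨h0, hdvd, w, -, hwn, hfw, hc⟩ := admissible_spec hα1.le hn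
    have hn0 : (0 : ℝ) < n := by exact_mod_cast h0
    have h1 : (0 : ℝ) < n.choose w := by exact_mod_cast Nat.choose_pos hwn
    have h2 : (0 : ℝ) < (n * q).choose (w * q) := by
      exact_mod_cast Nat.choose_pos (Nat.mul_le_mul_right q hwn)
    rw [hfw, expectedCount_eq K hdvd hwn, Real.log_div (mul_pos h1 hc).ne' h2.ne',
      Real.log_mul h1.ne' hc.ne', hmcast n hn]
    push_cast
    field_simp
    ring

end

end TannerEnsemble

theorem corollary2 {s : ℕ} (K : TannerEnsemble.LinCode s) (hK : K ≠ ⊥) (q : ℕ) (hq : 0 < q) :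
    Set.BijOn (TannerEnsemble.f K) (Set.Ici 0)
        (Set.Ico 0 ((TannerEnsemble.maxWeight K : ℝ) / (s : ℝ))) ∧
      ∀ α : ℚ, 0 ≤ α → (α : ℝ) < (TannerEnsemble.maxWeight K : ℝ) / (s : ℝ) →
        TannerEnsemble.HasSpectralShapeAt K q (α : ℝ)
          ((1 - (q : ℝ)) * Real.binEntropy (α : ℝ)
            - (q : ℝ) * (α : ℝ) * Real.log (TannerEnsemble.fInv K (α : ℝ))
            + (q : ℝ) / (s : ℝ) *
              Real.log ((TannerEnsemble.wef K).eval (TannerEnsemble.fInv K (α : ℝ)))) := by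
  refine ⟨TannerEnsemble.bijOn_f hK, fun α hα0 hα => ?_⟩
  rcases hα0.eq_or_lt with rfl | hα0
  · have h := TannerEnsemble.hasSpectralShapeAt_zero (K := K) (q := q)
      (TannerEnsemble.length_pos hK)
    -- At α = 0 the saddle point degenerates to 0; there A(0) = 1, and the logarithm of 0 is
    -- multiplied by 0.
    rw [Rat.cast_zero, TannerEnsemble.fInv_zero hK, ← Polynomial.coeff_zero_eq_eval_zero,
      TannerEnsemble.coeff_wef_zero]
    simpa using h
  · refine TannerEnsemble.hasSpectralShapeAt_of_pos hK hq (by exact_mod_cast hα0) hα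
      (a := α.num.toNat) (b := α.den) α.den_pos ?_
    have h1 : ((α.num.toNat : ℤ) : ℝ) = α.num := by
      rw [Int.toNat_of_nonneg (Rat.num_pos.2 hα0).le]
    rw [Int.cast_natCast] at h1
    rw [h1]
    exact_mod_cast Rat.mul_den_eq_num α
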